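/- Let $q\in\mathbb C$ with $0<|q|<1$, and fix a logarithm $\ell$ of $q$, so that $q^s:=e^{s\ell}$. Functions of $x\in\mathbb C\setminus\{0\}$ may be multivalued: they are regarded as functions of $u=\log x$, with $x^s:=e^{su}$, and $T_x f(x)=f(qx)$ is the shift $u\mapsto u+\ell$. Put $(z)_\infty=\prod_{n\ge0}(1-zq^n)$, $(z_1,\dots,z_r)_\infty=\prod_j (z_j)_\infty$, and $$\int_0^{\tau}f(t)\,d_qt=(1-q)\sum_{n\ge0}f(\tau q^n)\,\tau q^n,\qquad \int_{\tau_1}^{\tau_2}f(t)\,d_qt=\int_0^{\tau_2}f(t)\,d_qt-\int_0^{\tau_1}f(t)\,d_qt .$$ Let $A,B,a_1,a_2,a_3,b_1,b_2,b_3$ be nonzero complex numbers with $Aa_1a_2a_3=q^2Bb_1b_2b_3$. With $a=(a_1,a_2,a_3)$, $b=(b_1,b_2,b_3)$ and $e_i$ the elementary symmetric polynomial of degree $i$, let $$\mathcal E_3=\bigl[x^3(B-AT_x)(B-AqT_x)-x^2(e_1(a)-qe_1(b)T_x)(B-AT_x)+x(e_2(a)-qe_2(b)T_x)(1-T_x)-e_3(a)B^{-1}(1-q^{-1}T_x)(1-T_x)\bigr]T_x^{-1}.$$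 **(1)** Suppose that $B/A=q^\lambda\notin q^{\mathbb Z}$. Let $\tau_1,\tau_2\in\{q/a_1,q/a_2,q/a_3,q/(Ax)\}$ and $\sigma_1,\sigma_2\in\{b_1,b_2,b_3,Bx\}$. Then the functions $$\varphi(x)=\int_{\tau_1}^{\tau_2}\frac{(Axt,a_1t,a_2t,a_3t)_\infty}{(Bxt,b_1t,b_2t,b_3t)_\infty}\,d_qt,\qquad \tilde\varphi(x)=x^\lambda\int_{\sigma_1}^{\sigma_2}\frac{(qs/(Bx),qs/b_1,qs/b_2,qs/b_3)_\infty}{(qs/(Ax),qs/a_1,qs/a_2,qs/a_3)_\infty}\,d_qs$$ satisfy $\mathcal E_3f=0$. More precisely, call $\varphi$ (respectively $\tilde\varphi$) regular at $x\ne0$ if the denominator of its integrand vanishes at none of the points $\tau_jq^n$ (respectively $\sigma_jq^n$), $j=1,2$, $n\ge0$. Then the series defining it converge absolutely at every $x\neq 0$ where it is regular, and $(\mathcal E_3f)(x)=0$ at every $x$ for which it is regular at $q^{-1}x$, $x$ and $qx$. **(2)** For $\alpha,h_i,l_i\in\mathbb C$ and $t_i\in\mathbb C\setminus\{0\}$ ($i=1,2,3$),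 let $$\begin{aligned}\mathcal H_3={}&\prod_{i=1}^3(x-q^{h_i+1/2}t_i)\,T_x^{-1}+q^{2\alpha+1}\prod_{i=1}^3(x-q^{l_i-1/2}t_i)\,T_x+q^\alpha\Bigl[-(q+1)x^3+q^{1/2}\sum_{i=1}^3(q^{h_i}+q^{l_i})t_i\,x^2\\&-q^{(h_1+h_2+h_3+l_1+l_2+l_3+1)/2}\,t_1t_2t_3\sum_{i=1}^3\frac{q^{-h_i}+q^{-l_i}}{t_i}\,x+q^{(h_1+h_2+h_3+l_1+l_2+l_3)/2}(q+1)\,t_1t_2t_3\Bigr]\end{aligned}$$ be the operator of the variant of the $q$-hypergeometric equation of degree three, and put $\nu=\tfrac12(h_1+h_2+h_3-l_1-l_2-l_3+1)$. The equations $\mathcal E_3f=0$ and $\mathcal H_3g=0$ are identified by $$g(x)=x^{\nu-\alpha}f(x),\qquad q^{-\nu}=B/A,\qquad q^{l_i-1/2}t_i=b_i/A,\qquad q^{h_i+1/2}t_i=a_i/B\quad(i=1,2,3).\tag{$*$}$$ That is: for all nonzero $A,B,a_i,b_i$ with $Aa_1a_2a_3=q^2Bb_1b_2b_3$ there are $h_i,l_i$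 and $t_i\ne0$ satisfying $(*)$; for all $h_i,l_i$ and $t_i\neq0$ there are nonzero $A,B,a_i,b_i$ with $Aa_1a_2a_3=q^2Bb_1b_2b_3$ satisfying $(*)$; and whenever the parameters satisfy $(*)$, for every $\alpha$ there is a constant $c\ne0$ with $\mathcal H_3\,x^{\nu-\alpha}=c\,x^{\nu-\alpha}\mathcal E_3$ as operators, so that, for every function $f$ and at every point, $\mathcal E_3f$ vanishes if and only if $\mathcal H_3(x^{\nu-\alpha}f)$ does. -/

import Mathlib

noncomputable section

namespace VariantQHyp

/-! ### Infinite `q`-shifted factorials and Jackson integrals -/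

/-- The infinite `q`-shifted factorial `(z)_∞ = ∏_{n ≥ 0} (1 - z q ^ n)`. -/
def qPoch (q z : ℂ) : ℂ := ∏' n : ℕ, (1 - z * q ^ n)

/-- The `n`-th term of the series (without the factor `1 - q`) which defines the Jackson integral
`∫_0^τ f(t) d_q t`. -/
def jacksonTerm (q : ℂ) (f : ℂ → ℂ) (τ : ℂ) (n : ℕ) : ℂ := f (τ * q ^ n) * (τ * q ^ n)

/-- `∫_0^τ f(t) d_q t = (1 - q) ∑_{n ≥ 0} f(τ q ^ n) τ q ^ n`. -/
def jacksonZero (q : ℂ) (f : ℂ → ℂ) (τ : ℂ) : ℂ := (1 - q) * ∑' n : ℕ, jacksonTerm q f τ n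

/-- `∫_{τ₁}^{τ₂} f(t) d_q t = ∫_0^{τ₂} f(t) d_q t - ∫_0^{τ₁} f(t) d_q t`. -/
def jackson (q : ℂ) (f : ℂ → ℂ) (τ₁ τ₂ : ℂ) : ℂ := jacksonZero q f τ₂ - jacksonZero q f τ₁

/-! ### The two integrands

Both integrands are quotients of two products of the same shape. -/

/-- The product `(C x t, c₁ t, c₂ t, c₃ t)_∞`. -/
def prodPsi (q C : ℂ) (c : Fin 3 → ℂ) (x t : ℂ) : ℂ :=
  qPoch q (C * x * t) * ∏ i, qPoch q (c i * t)

/-- The integrand `(A x t, a₁ t, a₂ t, a₃ t)_∞ / (B x t, b₁ t, b₂ t, b₃ t)_∞`. -/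
def psi (q A B : ℂ) (a b : Fin 3 → ℂ) (x t : ℂ) : ℂ :=
  prodPsi q A a x t / prodPsi q B b x t

/-- The product `(q s / (C x), q s / c₁, q s / c₂, q s / c₃)_∞`. -/
def prodPsiTilde (q C : ℂ) (c : Fin 3 → ℂ) (x s : ℂ) : ℂ :=
  qPoch q (q * s / (C * x)) * ∏ i, qPoch q (q * s / c i)

/-- The integrand
`(q s / (B x), q s / b₁, q s / b₂, q s / b₃)_∞ / (q s / (A x), q s / a₁, q s / a₂, q s / a₃)_∞`. -/
def psiTilde (q A B : ℂ) (a b : Fin 3 → ℂ) (x s : ℂ) : ℂ :=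
  prodPsiTilde q B b x s / prodPsiTilde q A a x s

/-- The denominator `D` of an integrand does not vanish at any of the points `τ q ^ n`, `n ≥ 0`,
at which the Jackson integral `∫_0^τ` evaluates that integrand. -/
def NoPole (q : ℂ) (D : ℂ → ℂ) (τ : ℂ) : Prop := ∀ n : ℕ, D (τ * q ^ n) ≠ 0

/-- The endpoints `q / a₁`, `q / a₂`, `q / a₃`, `q / (A x)`, as functions of `x`. -/
def tauSet (q A : ℂ) (a : Fin 3 → ℂ) : Set (ℂ → ℂ) :=
  {fun _ => q / a 0, fun _ => q / a 1, fun _ => q / a 2, fun x => q / (A * x)}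

/-- The endpoints `b₁`, `b₂`, `b₃`, `B x`, as functions of `x`. -/
def sigmaSet (B : ℂ) (b : Fin 3 → ℂ) : Set (ℂ → ℂ) :=
  {fun _ => b 0, fun _ => b 1, fun _ => b 2, fun x => B * x}

/-- `φ₃(x, τ₁, τ₂) = ∫_{τ₁(x)}^{τ₂(x)} ψ(x, t) d_q t`. -/
def phi (q A B : ℂ) (a b : Fin 3 → ℂ) (τ₁ τ₂ : ℂ → ℂ) (x : ℂ) : ℂ :=
  jackson q (psi q A B a b x) (τ₁ x) (τ₂ x)

/-- `∫_{σ₁(x)}^{σ₂(x)} ψ~(x, s) d_q s`, without the prefactor `x ^ lam`. -/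
def phiTilde (q A B : ℂ) (a b : Fin 3 → ℂ) (σ₁ σ₂ : ℂ → ℂ) (x : ℂ) : ℂ :=
  jackson q (psiTilde q A B a b x) (σ₁ x) (σ₂ x)

/-- `φ₃(x, τ₁, τ₂)` has no vanishing denominator at the point `x`. -/
def PhiRegular (q B : ℂ) (b : Fin 3 → ℂ) (τ₁ τ₂ : ℂ → ℂ) (x : ℂ) : Prop :=
  NoPole q (prodPsi q B b x) (τ₁ x) ∧ NoPole q (prodPsi q B b x) (τ₂ x)

/-- The integral `∫_{σ₁(x)}^{σ₂(x)} ψ~(x, s) d_q s` has no vanishing denominator at `x`. -/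
def PhiTildeRegular (q A : ℂ) (a : Fin 3 → ℂ) (σ₁ σ₂ : ℂ → ℂ) (x : ℂ) : Prop :=
  NoPole q (prodPsiTilde q A a x) (σ₁ x) ∧ NoPole q (prodPsiTilde q A a x) (σ₂ x)

/-! ### `q`-difference operators

Since `x ^ lam` is multivalued, a (possibly multivalued) function of `x ∈ ℂ \ {0}` is given by a
function of the logarithmic variable `u`, with `x = exp u`. Having fixed a logarithm `l` of `q`,
the shift `x ↦ q x` is `u ↦ u + l`, the power `x ^ s` is `exp (s u)` and `q ^ s` is `exp (s l)`. -/

/-- The power `q ^ s`, for the logarithm `l` of `q`. -/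
def qPow (l s : ℂ) : ℂ := Complex.exp (s * l)

/-- The multivalued function `x ^ s`, in the variable `u` with `x = exp u`. -/
def xPow (s u : ℂ) : ℂ := Complex.exp (s * u)

/-- Linear operators on functions of `u`; the product is composition. -/
abbrev Op : Type := Module.End ℂ (ℂ → ℂ)

/-- The `q`-shift `T_x`, which is `f(u) ↦ f(u + l)`. -/
def opT (l : ℂ) : Op := LinearMap.funLeft ℂ ℂ fun u => u + l

/-- The inverse `q`-shift `T_x⁻¹`, which is `f(u) ↦ f(u - l)`. -/
def opTinv (l : ℂ) : Op := LinearMap.funLeft ℂ ℂ fun u => u - l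

/-- Multiplication by a function of `u`. -/
def opMul (m : ℂ → ℂ) : Op := LinearMap.mulLeft ℂ m

/-- Multiplication by `x`. -/
def opX : Op := opMul Complex.exp

/-- Elementary symmetric polynomial of degree one. -/
def e1 (c : Fin 3 → ℂ) : ℂ := c 0 + c 1 + c 2

/-- Elementary symmetric polynomial of degree two. -/
def e2 (c : Fin 3 → ℂ) : ℂ := c 0 * c 1 + c 0 * c 2 + c 1 * c 2

/-- Elementary symmetric polynomial of degree three. -/
def e3 (c : Fin 3 → ℂ) : ℂ := c 0 * c 1 * c 2

/-- The operator `𝓔₃`, for a logarithm `l` of `q`. -/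
def opE3 (q l A B : ℂ) (a b : Fin 3 → ℂ) : Op :=
  (opX ^ 3 * (B • 1 - A • opT l) * (B • 1 - (A * q) • opT l)
    - opX ^ 2 * (e1 a • 1 - (q * e1 b) • opT l) * (B • 1 - A • opT l)
    + opX * (e2 a • 1 - (q * e2 b) • opT l) * (1 - opT l)
    - (e3 a * B⁻¹) • ((1 - q⁻¹ • opT l) * (1 - opT l))) * opTinv l

/-- The operator `𝓗₃` of the variant of the `q`-hypergeometric equation of degree three. -/
def opH3 (q l α : ℂ) (h k t : Fin 3 → ℂ) : Op :=
  opMul (fun u => ∏ i, (Complex.exp u - qPow l (h i + 1 / 2) * t i)) * opTinv l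
    + qPow l (2 * α + 1) •
        (opMul (fun u => ∏ i, (Complex.exp u - qPow l (k i - 1 / 2) * t i)) * opT l)
    + qPow l α •
        (-(q + 1) • opX ^ 3
          + (qPow l (1 / 2) * ∑ i, (qPow l (h i) + qPow l (k i)) * t i) • opX ^ 2
          - (qPow l ((∑ i, h i + ∑ i, k i + 1) / 2) * (∏ i, t i)
              * ∑ i, (qPow l (-h i) + qPow l (-k i)) / t i) • opX
          + (qPow l ((∑ i, h i + ∑ i, k i) / 2) * (q + 1) * ∏ i, t i) • (1 : Op))

/-- `ν = (h₁ + h₂ + h₃ - k₁ - k₂ - k₃ + 1) / 2`. -/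
def nu (h k : Fin 3 → ℂ) : ℂ := (∑ i, h i - ∑ i, k i + 1) / 2

/-- The change of parameters between `𝓔₃` and `𝓗₃`:
`q ^ (-ν) = B / A`, `q ^ (kᵢ - 1/2) tᵢ = bᵢ / A`, `q ^ (hᵢ + 1/2) tᵢ = aᵢ / B`. -/
def ParamChange (l A B : ℂ) (a b h k t : Fin 3 → ℂ) : Prop :=
  qPow l (-nu h k) = B / A ∧
    (∀ i, qPow l (k i - 1 / 2) * t i = b i / A) ∧
    ∀ i, qPow l (h i + 1 / 2) * t i = a i / B

end VariantQHyp

end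

open VariantQHyp

open VariantQHyp

noncomputable section

namespace VariantQHyp

/-! The Jackson integrals are handled by creative telescoping. Applied in `x` to `ψ(x,t) t`, the
operator gives `P(t) - P(qt)` for an explicit `P` (`telescope`), and `P(τ q^n)` tends to `q x²(B -
A)` whatever `τ` is. Hence a series starting at a zero of `P` contributes a value independent of `τ`
(`coeff_tsum_eq`), and two such contributions cancel. The points `q/aᵢ` are zeros of `P`; the moving
endpoint `q/(Ax)` is reduced to the zero `1/(Ax)`, because the integrand vanishes at the points
added (`coeff_tsum_tauSet`). The second family comes from the first by `x ↦ 1/x`, which exchanges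
the outer coefficients of the operator up to the factors produced by `x^λ` (`coeff_inv`). For `𝓗₃`,
conjugation by `x^(ν-α)` matches the three coefficients (`opH3_xPow_apply`). Existence of parameters
is a matter of taking logarithms, apart from a sign of `q^ν` (`exists_paramChange`). -/

/-! ### Infinite products and convergence of Jackson sums. -/

theorem multipliable_qPoch {q : ℂ} (hq : ‖q‖ < 1) (z : ℂ) :
    Multipliable fun n : ℕ => 1 - z * q ^ n := by
  have : Summable fun n : ℕ => ‖-(z * q ^ n)‖ := by
    simpa [norm_mul] using (summable_geometric_of_lt_one (norm_nonneg q) hq).mul_left ‖z‖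
  simpa [sub_eq_add_neg] using multipliable_one_add_of_summable this

theorem qPoch_eq_mul {q : ℂ} (hq : ‖q‖ < 1) (z : ℂ) :
    qPoch q z = (1 - z) * qPoch q (q * z) := by
  have h : ∀ n : ℕ, 1 - z * q ^ (n + 1) = 1 - q * z * q ^ n := fun n => by ring
  have hm : Multipliable fun n : ℕ => 1 - z * q ^ (n + 1) := by
    simpa only [h] using multipliable_qPoch hq (q * z)
  calc qPoch q z = (1 - z * q ^ 0) * ∏' n : ℕ, (1 - z * q ^ (n + 1)) := tprod_eq_zero_mul' hm
    _ = (1 - z) * qPoch q (q * z) := by rw [pow_zero, mul_one, tprod_congr h, qPoch]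

theorem qPoch_one {q : ℂ} (hq : ‖q‖ < 1) : qPoch q 1 = 0 := by
  rw [qPoch_eq_mul hq]; simp

theorem qPoch_inv {q : ℂ} (hq0 : q ≠ 0) (hq : ‖q‖ < 1) : qPoch q q⁻¹ = 0 := by
  rw [qPoch_eq_mul hq, mul_inv_cancel₀ hq0, qPoch_one hq, mul_zero]

/-- Zeros of the `q`-shifted factorial are integral powers of `q`. -/
theorem qPoch_ne_zero {q z : ℂ} (hq : ‖q‖ < 1) (hz : ∀ n : ℤ, z ≠ q ^ n) :
    qPoch q z ≠ 0 := by
  unfold qPoch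
  have hs : Summable fun n : ℕ => ‖-(z * q ^ n)‖ := by
    simpa [norm_mul] using (summable_geometric_of_lt_one (norm_nonneg q) hq).mul_left ‖z‖
  have := tprod_one_add_ne_zero_of_summable (f := fun n : ℕ => -(z * q ^ n)) (fun n h => by
    apply hz (-(n : ℤ))
    rw [zpow_neg, zpow_natCast, eq_comm, inv_eq_iff_eq_inv, eq_comm]
    exact inv_eq_of_mul_eq_one_right (by linear_combination -h)) hs
  simpa [sub_eq_add_neg] using this

/-- The bound `|(z)_∞ - 1| ≤ exp(|z|/(1 - |q|)) - 1`, inherited from the finite products, gives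
continuity at `z = 0`. -/
theorem tendsto_qPoch {q : ℂ} (hq : ‖q‖ < 1) (c : ℂ) :
    Filter.Tendsto (fun n : ℕ => qPoch q (c * q ^ n)) Filter.atTop (nhds 1) := by
  have key : ∀ z : ℂ, ‖qPoch q z - 1‖ ≤ Real.exp (‖z‖ * (1 - ‖q‖)⁻¹) - 1 := fun z => by
    have hs : Summable fun n : ℕ => ‖-(z * q ^ n)‖ := by
      simpa [norm_mul] using (summable_geometric_of_lt_one (norm_nonneg q) hq).mul_left ‖z‖
    have hlim : Filter.Tendsto (fun N => ‖∏ n ∈ Finset.range N, (1 + -(z * q ^ n)) - 1‖)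
        Filter.atTop (nhds ‖qPoch q z - 1‖) := by
      have := (multipliable_qPoch hq z).hasProd.tendsto_prod_nat
      simp only [sub_eq_add_neg (1 : ℂ)] at this
      exact (this.sub_const 1).norm
    refine le_of_tendsto' hlim fun N => (Finset.norm_prod_one_add_sub_one_le _ _).trans ?_
    have hle := hs.sum_le_tsum (Finset.range N) fun _ _ => norm_nonneg _
    have heq : ∑' n : ℕ, ‖-(z * q ^ n)‖ = ‖z‖ * (1 - ‖q‖)⁻¹ := by
      simp [tsum_mul_left, tsum_geometric_of_lt_one (norm_nonneg q) hq]
    rw [heq] at hle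
    gcongr
  rw [tendsto_iff_norm_sub_tendsto_zero]
  refine squeeze_zero (fun _ => norm_nonneg _) (fun n => key (c * q ^ n)) ?_
  have h : Filter.Tendsto (fun n : ℕ => c * q ^ n) Filter.atTop (nhds (c * 0)) :=
    (tendsto_pow_atTop_nhds_zero_of_norm_lt_one hq).const_mul c
  have h2 : Continuous fun z : ℂ => Real.exp (‖z‖ * (1 - ‖q‖)⁻¹) - 1 := by fun_prop
  simpa [Function.comp_def] using (h2.tendsto _).comp h

theorem tendsto_prodPsi {q : ℂ} (hq : ‖q‖ < 1) (C : ℂ) (c : Fin 3 → ℂ) (x τ : ℂ) :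
    Filter.Tendsto (fun n : ℕ => prodPsi q C c x (τ * q ^ n)) Filter.atTop (nhds 1) := by
  unfold prodPsi
  have := (tendsto_qPoch hq (C * x * τ)).mul
    (tendsto_finsetProd Finset.univ fun i _ => tendsto_qPoch hq (c i * τ))
  simpa [mul_assoc] using this

/-- The integrand tends to `1` along `τ q^n`, so the terms are dominated by a geometric series.
Denominators can vanish for finitely many `n` only, where the quotient is `0` by convention. -/
theorem summable_jacksonTerm_psi {q : ℂ} (hq : ‖q‖ < 1) (A B : ℂ) (a b : Fin 3 → ℂ) (x τ : ℂ) :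
    Summable (jacksonTerm q (psi q A B a b x) τ) := by
  have h : Filter.Tendsto (fun n : ℕ => psi q A B a b x (τ * q ^ n)) Filter.atTop (nhds 1) := by
    simpa [psi, Pi.div_def] using
      (tendsto_prodPsi hq A a x τ).div (tendsto_prodPsi hq B b x τ) one_ne_zero
  have hg : Summable fun n : ℕ => ‖τ * q ^ n‖ := by
    simpa [norm_mul] using (summable_geometric_of_lt_one (norm_nonneg q) hq).mul_left ‖τ‖
  refine summable_of_isBigO_nat hg ?_
  have := (h.isBigO_one ℂ).mul (Asymptotics.isBigO_refl (fun n : ℕ => τ * q ^ n) Filter.atTop)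
  simp only [one_mul] at this
  exact this.norm_right

theorem tsum_jacksonTerm_eq_of_zero {q : ℂ} {f : ℂ → ℂ} {τ : ℂ} (hs : Summable (jacksonTerm q f τ))
    (h0 : f τ = 0) : ∑' n, jacksonTerm q f τ n = ∑' n, jacksonTerm q f (τ * q) n := by
  rw [hs.tsum_eq_zero_add]
  simp [jacksonTerm, h0, pow_succ', mul_assoc]

/-! ### The operator `𝓔₃` in terms of its coefficients -/

/-- The coefficient of `T_x⁻¹` in `𝓔₃`. -/
def coeffPrev (B : ℂ) (a : Fin 3 → ℂ) (x : ℂ) : ℂ :=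
  B ^ 2 * x ^ 3 - e1 a * B * x ^ 2 + e2 a * x - e3 a * B⁻¹

/-- The coefficient of the identity in `𝓔₃`. -/
def coeffId (q A B : ℂ) (a b : Fin 3 → ℂ) (x : ℂ) : ℂ :=
  -(1 + q) * A * B * x ^ 3 + (e1 a * A + q * e1 b * B) * x ^ 2 - (e2 a + q * e2 b) * x
    + e3 a * B⁻¹ * (1 + q⁻¹)

/-- The coefficient of `T_x` in `𝓔₃`. -/
def coeffNext (q A B : ℂ) (a b : Fin 3 → ℂ) (x : ℂ) : ℂ :=
  A ^ 2 * q * x ^ 3 - q * e1 b * A * x ^ 2 + q * e2 b * x - e3 a * B⁻¹ * q⁻¹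

theorem opE3_apply (q l A B : ℂ) (a b : Fin 3 → ℂ) (f : ℂ → ℂ) (u : ℂ) :
    opE3 q l A B a b f u = coeffPrev B a (Complex.exp u) * f (u - l)
      + coeffId q A B a b (Complex.exp u) * f u
      + coeffNext q A B a b (Complex.exp u) * f (u + l) := by
  simp only [opE3, opX, opMul, opT, opTinv, coeffPrev, coeffId, coeffNext, Module.End.mul_apply,
    LinearMap.sub_apply, LinearMap.add_apply, LinearMap.smul_apply, Module.End.one_apply,
    LinearMap.funLeft_apply, LinearMap.mulLeft_apply, Pi.sub_apply, Pi.add_apply, Pi.smul_apply,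
    Pi.mul_apply, smul_eq_mul, pow_succ, pow_zero, one_mul, add_sub_cancel_right]
  ring

/-! ### The telescoping identity -/

theorem prodPsi_eq_mul {q : ℂ} (hq : ‖q‖ < 1) (C : ℂ) (c : Fin 3 → ℂ) (x t : ℂ) :
    prodPsi q C c x t = (1 - C * x * t) * prodPsi q C c (q * x) t := by
  unfold prodPsi
  rw [qPoch_eq_mul hq (C * x * t), show q * (C * x * t) = C * (q * x) * t by ring]
  ring

theorem prodPsi_eq_mul_arg {q : ℂ} (hq : ‖q‖ < 1) (C : ℂ) (c : Fin 3 → ℂ) (x t : ℂ) :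
    prodPsi q C c x t =
      (1 - C * x * t) * (∏ i, (1 - c i * t)) * prodPsi q C c x (q * t) := by
  unfold prodPsi
  rw [qPoch_eq_mul hq (C * x * t), Finset.prod_congr rfl fun i _ => qPoch_eq_mul hq (c i * t),
    Finset.prod_mul_distrib]
  simp only [show ∀ c, q * (c * t) = c * (q * t) from fun c => by ring]
  ring

/-- The function of `t` whose differences are the terms of `𝓔₃` applied to the Jackson sum. -/
def primitive (q A B : ℂ) (a b : Fin 3 → ℂ) (x t : ℂ) : ℂ :=
  q * x ^ 2 * (B - A) * (1 - A * x * t) * (∏ i, (1 - a i * t / q)) *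
    (prodPsi q A a (q * x) t / prodPsi q B b (x / q) t)

/-- With `N` the numerator at `qx` and `D` the denominator at `x/q`, every term is a polynomial in
`t` times `N/D`. What remains is a polynomial identity modulo the balancing condition. -/
theorem telescope {q A B : ℂ} {a b : Fin 3 → ℂ} (hq0 : q ≠ 0) (hq : ‖q‖ < 1) (hB : B ≠ 0)
    (hAB : A * e3 a = q ^ 2 * B * e3 b) {x t : ℂ} (hD : prodPsi q B b (x / q) t ≠ 0) :
    coeffPrev B a x * (psi q A B a b (x / q) t * t) + coeffId q A B a b x * (psi q A B a b x t * t)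
      + coeffNext q A B a b x * (psi q A B a b (q * x) t * t)
      = primitive q A B a b x t - primitive q A B a b x (q * t) := by
  have hxq : q * (x / q) = x := by field_simp
  set N := prodPsi q A a (q * x) t with hN
  set D := prodPsi q B b (x / q) t with hDdef
  have hD1 : D = (1 - B * (x / q) * t) * prodPsi q B b x t := by
    rw [hDdef, prodPsi_eq_mul hq, hxq]
  have hD2 : prodPsi q B b x t = (1 - B * x * t) * prodPsi q B b (q * x) t :=
    prodPsi_eq_mul hq ..
  have hN1 : prodPsi q A a x t = (1 - A * x * t) * N := prodPsi_eq_mul hq ..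
  have hN2 : prodPsi q A a (x / q) t = (1 - A * (x / q) * t) * ((1 - A * x * t) * N) := by
    rw [prodPsi_eq_mul hq, hxq, hN1]
  have hD3 : D = (1 - B * (x / q) * t) * (∏ i, (1 - b i * t)) * prodPsi q B b (x / q) (q * t) :=
    prodPsi_eq_mul_arg hq ..
  have hN3 : N = (1 - A * (q * x) * t) * (∏ i, (1 - a i * t)) * prodPsi q A a (q * x) (q * t) :=
    prodPsi_eq_mul_arg hq ..
  have p0 : psi q A B a b (x / q) t = (1 - A * (x / q) * t) * (1 - A * x * t) * (N / D) := by
    rw [psi, hN2]; ring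
  have nz1 : 1 - B * (x / q) * t ≠ 0 := fun h => hD (by rw [hD1, h, zero_mul])
  have nz2 : prodPsi q B b x t ≠ 0 := fun h => hD (by rw [hD1, h, mul_zero])
  have nz3 : 1 - B * x * t ≠ 0 := fun h => nz2 (by rw [hD2, h, zero_mul])
  have nz4 : prodPsi q B b (q * x) t ≠ 0 := fun h => nz2 (by rw [hD2, h, mul_zero])
  have p1 : psi q A B a b x t = (1 - B * (x / q) * t) * (1 - A * x * t) * (N / D) := by
    rw [psi, hN1, hD1, div_eq_iff nz2]
    rw [← mul_div_assoc, div_mul_eq_mul_div, eq_div_iff (mul_ne_zero nz1 nz2)]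
    ring
  have p2 : psi q A B a b (q * x) t = (1 - B * (x / q) * t) * (1 - B * x * t) * (N / D) := by
    rw [psi, hD1, hD2, ← hN, div_eq_iff nz4, ← mul_div_assoc, div_mul_eq_mul_div,
      eq_div_iff (mul_ne_zero nz1 (mul_ne_zero nz3 nz4))]
    ring
  have g : primitive q A B a b x (q * t) = q * x ^ 2 * (B - A) * (1 - B * (x / q) * t) *
      (∏ i, (1 - b i * t)) * (N / D) := by
    have hc : ∀ i, 1 - a i * (q * t) / q = 1 - a i * t := fun i => by field_simp
    have hd : (1 - B * (x / q) * t) * (∏ i, (1 - b i * t)) ≠ 0 := fun h =>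
      hD (by rw [hD3, h, zero_mul])
    have : N / D * ((1 - B * (x / q) * t) * ∏ i, (1 - b i * t))
        = N / prodPsi q B b (x / q) (q * t) := by
      rw [hD3, div_mul_eq_mul_div, mul_comm N, mul_div_mul_left _ _ hd]
    simp only [primitive, hc]
    linear_combination (-(q * x ^ 2 * (B - A))) * this - (q * x ^ 2 * (B - A) /
      prodPsi q B b (x / q) (q * t)) * hN3
  rw [p0, p1, p2, g, primitive, ← hN, ← hDdef]
  generalize N / D = W
  simp only [coeffPrev, coeffId, coeffNext, e1, e2, e3, Fin.prod_univ_three] at hAB ⊢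
  -- The `t⁴` multiplier cancels the leading terms on the right, as the left side has degree three
  -- in `t`; the `t³` multiplier reconciles `e3 a` with `e3 b`.
  linear_combination (norm := (field_simp; ring))
    W * x ^ 2 * (B - A) * (t ^ 3 / (B * q) - x * t ^ 4 / q ^ 2) * hAB

theorem tendsto_primitive {q : ℂ} (hq : ‖q‖ < 1) (A B : ℂ) (a b : Fin 3 → ℂ) (x τ : ℂ) :
    Filter.Tendsto (fun n : ℕ => primitive q A B a b x (τ * q ^ n)) Filter.atTop
      (nhds (q * x ^ 2 * (B - A))) := by
  have h : Filter.Tendsto (fun n : ℕ => τ * q ^ n) Filter.atTop (nhds 0) := by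
    simpa using (tendsto_pow_atTop_nhds_zero_of_norm_lt_one hq).const_mul τ
  have hc : Continuous fun t : ℂ =>
      q * x ^ 2 * (B - A) * (1 - A * x * t) * (∏ i, (1 - a i * t / q)) := by fun_prop
  simpa [primitive, Function.comp_def] using ((hc.tendsto 0).comp h).mul
    ((tendsto_prodPsi hq A a (q * x) τ).div (tendsto_prodPsi hq B b (x / q) τ) one_ne_zero)

theorem coeff_tsum_eq {q A B : ℂ} {a b : Fin 3 → ℂ} (hq0 : q ≠ 0) (hq : ‖q‖ < 1) (hB : B ≠ 0)
    (hAB : A * e3 a = q ^ 2 * B * e3 b) {x τ : ℂ}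
    (hD : NoPole q (prodPsi q B b (x / q)) τ) (h0 : primitive q A B a b x τ = 0) :
    coeffPrev B a x * ∑' n, jacksonTerm q (psi q A B a b (x / q)) τ n
      + coeffId q A B a b x * ∑' n, jacksonTerm q (psi q A B a b x) τ n
      + coeffNext q A B a b x * ∑' n, jacksonTerm q (psi q A B a b (q * x)) τ n
      = -(q * x ^ 2 * (B - A)) := by
  have hs := fun y => (summable_jacksonTerm_psi hq A B a b y τ).hasSum
  have h1 := ((((hs (x / q)).mul_left (coeffPrev B a x)).add
    ((hs x).mul_left (coeffId q A B a b x))).add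
    ((hs (q * x)).mul_left (coeffNext q A B a b x))).tendsto_sum_nat
  refine tendsto_nhds_unique h1 ?_
  have h2 := (tendsto_primitive hq A B a b x τ).const_sub 0
  rw [zero_sub] at h2
  -- The `N`-th partial sum collapses to `0 - P(τ q^N)`.
  refine h2.congr fun N => ?_
  have h3 : ∀ n : ℕ, q * (τ * q ^ n) = τ * q ^ (n + 1) := fun n => by ring
  have h4 : primitive q A B a b x (τ * q ^ 0) = 0 := by simpa using h0
  simp only [jacksonTerm]
  rw [Finset.sum_congr rfl fun n _ => telescope hq0 hq hB hAB (hD n)]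
  simp only [h3]
  rw [Finset.sum_range_sub' fun n => primitive q A B a b x (τ * q ^ n), h4]

theorem psi_eq_zero {q A B : ℂ} {a b : Fin 3 → ℂ} {x t : ℂ} (h : qPoch q (A * x * t) = 0) :
    psi q A B a b x t = 0 := by
  simp [psi, prodPsi, h]

/-- Only the first factor depends on `x`. At these points its argument is `(B/A) q^(n-1)`, never an
integral power of `q`; the other factors are read off from the denominator at `y`. -/
theorem prodPsi_div_ne_zero {q A B : ℂ} {b : Fin 3 → ℂ} (hq0 : q ≠ 0) (hq : ‖q‖ < 1) (hA : A ≠ 0)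
    (hBA : ∀ n : ℤ, B / A ≠ q ^ n) {x y t : ℂ} (hx : x ≠ 0) {n : ℕ} (ht : t = 1 / (A * x) * q ^ n)
    (h : prodPsi q B b y t ≠ 0) : prodPsi q B b (x / q) t ≠ 0 := by
  refine mul_ne_zero (qPoch_ne_zero hq fun m hm => hBA (m + 1 - n) ?_) (right_ne_zero_of_mul h)
  rw [zpow_sub₀ hq0, zpow_add_one₀ hq0, ← hm, ht, zpow_natCast]
  field_simp

theorem coeff_tsum_tauSet {q A B : ℂ} {a b : Fin 3 → ℂ} (hq0 : q ≠ 0) (hq : ‖q‖ < 1) (hA : A ≠ 0)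
    (hB : B ≠ 0) (ha : ∀ i, a i ≠ 0) (hBA : ∀ n : ℤ, B / A ≠ q ^ n)
    (hAB : A * e3 a = q ^ 2 * B * e3 b) {x : ℂ} (hx : x ≠ 0) {τ : ℂ → ℂ} (hτ : τ ∈ tauSet q A a)
    (h1 : NoPole q (prodPsi q B b (x / q)) (τ (x / q)))
    (h2 : NoPole q (prodPsi q B b (q * x)) (τ (q * x))) :
    coeffPrev B a x * ∑' n, jacksonTerm q (psi q A B a b (x / q)) (τ (x / q)) n
      + coeffId q A B a b x * ∑' n, jacksonTerm q (psi q A B a b x) (τ x) n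
      + coeffNext q A B a b x * ∑' n, jacksonTerm q (psi q A B a b (q * x)) (τ (q * x)) n
      = -(q * x ^ 2 * (B - A)) := by
  have hconst : ∀ i, primitive q A B a b x (q / a i) = 0 := fun i => by
    have : ∏ j, (1 - a j * (q / a i) / q) = 0 :=
      Finset.prod_eq_zero (Finset.mem_univ i) (by have := ha i; field_simp; ring)
    simp [primitive, this]
  rcases hτ with rfl | rfl | rfl | rfl
  · exact coeff_tsum_eq hq0 hq hB hAB h1 (hconst 0)
  · exact coeff_tsum_eq hq0 hq hB hAB h1 (hconst 1)
  · exact coeff_tsum_eq hq0 hq hB hAB h1 (hconst 2)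
  -- The endpoints at `qx`, `x`, `x/q` are `1/(Ax)` times `1`, `q`, `q²`. The integrand at `x`
  -- vanishes at `1/(Ax)`, and the one at `x/q` at `1/(Ax)` and `q/(Ax)`, so all three series may
  -- start at `1/(Ax)`.
  · have hn : q / (A * (q * x)) = 1 / (A * x) := by field_simp
    have hi : q / (A * x) = 1 / (A * x) * q := by field_simp
    have hp : q / (A * (x / q)) = 1 / (A * x) * q * q := by field_simp
    simp only [hn, hi, hp] at h2 ⊢
    have hs := summable_jacksonTerm_psi hq A B a b
    have z1 : psi q A B a b x (1 / (A * x)) = 0 := by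
      apply psi_eq_zero
      rw [show A * x * (1 / (A * x)) = 1 by field_simp, qPoch_one hq]
    have z2 : psi q A B a b (x / q) (1 / (A * x)) = 0 := by
      apply psi_eq_zero
      rw [show A * (x / q) * (1 / (A * x)) = q⁻¹ by field_simp, qPoch_inv hq0 hq]
    have z3 : psi q A B a b (x / q) (1 / (A * x) * q) = 0 := by
      apply psi_eq_zero
      rw [show A * (x / q) * (1 / (A * x) * q) = 1 by field_simp, qPoch_one hq]
    rw [← tsum_jacksonTerm_eq_of_zero (hs ..) z1, ← tsum_jacksonTerm_eq_of_zero (hs ..) z3,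
      ← tsum_jacksonTerm_eq_of_zero (hs ..) z2]
    refine coeff_tsum_eq hq0 hq hB hAB
      (fun n => prodPsi_div_ne_zero hq0 hq hA hBA hx rfl (h2 n)) ?_
    rw [primitive, show 1 - A * x * (1 / (A * x)) = 0 by field_simp; ring]
    simp

theorem coeff_phi_eq_zero {q A B : ℂ} {a b : Fin 3 → ℂ} (hq0 : q ≠ 0) (hq : ‖q‖ < 1) (hA : A ≠ 0)
    (hB : B ≠ 0) (ha : ∀ i, a i ≠ 0) (hBA : ∀ n : ℤ, B / A ≠ q ^ n)
    (hAB : A * e3 a = q ^ 2 * B * e3 b) {x : ℂ} (hx : x ≠ 0) {τ₁ τ₂ : ℂ → ℂ}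
    (hτ₁ : τ₁ ∈ tauSet q A a) (hτ₂ : τ₂ ∈ tauSet q A a)
    (h1 : PhiRegular q B b τ₁ τ₂ (x / q)) (h2 : PhiRegular q B b τ₁ τ₂ (q * x)) :
    coeffPrev B a x * phi q A B a b τ₁ τ₂ (x / q) + coeffId q A B a b x * phi q A B a b τ₁ τ₂ x
      + coeffNext q A B a b x * phi q A B a b τ₁ τ₂ (q * x) = 0 := by
  have k1 := coeff_tsum_tauSet hq0 hq hA hB ha hBA hAB hx hτ₁ h1.1 h2.1
  have k2 := coeff_tsum_tauSet hq0 hq hA hB ha hBA hAB hx hτ₂ h1.2 h2.2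
  simp only [phi, jackson, jacksonZero]
  linear_combination (1 - q) * k2 - (1 - q) * k1

/-! ### The second family, by the symmetry `x ↦ 1 / x` -/

theorem prodPsiTilde_eq (q C : ℂ) (c : Fin 3 → ℂ) (x s : ℂ) :
    prodPsiTilde q C c x s = prodPsi q (q / C) (fun i => q / c i) x⁻¹ s := by
  have h : q / C * x⁻¹ * s = q * s / (C * x) := by
    simp only [div_eq_mul_inv, mul_inv]; ring
  rw [prodPsiTilde, prodPsi, h]
  simp only [div_mul_eq_mul_div]

theorem psiTilde_eq (q A B : ℂ) (a b : Fin 3 → ℂ) (x : ℂ) :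
    psiTilde q A B a b x =
      psi q (q / B) (q / A) (fun i => q / b i) (fun i => q / a i) x⁻¹ := by
  ext s
  simp only [psiTilde, psi, prodPsiTilde_eq]

theorem phiTilde_eq (q A B : ℂ) (a b : Fin 3 → ℂ) (σ₁ σ₂ : ℂ → ℂ) (x : ℂ) :
    phiTilde q A B a b σ₁ σ₂ x =
      phi q (q / B) (q / A) (fun i => q / b i) (fun i => q / a i)
        (fun y => σ₁ y⁻¹) (fun y => σ₂ y⁻¹) x⁻¹ := by
  simp only [phiTilde, phi, psiTilde_eq, inv_inv]

theorem PhiTildeRegular.phiRegular {q A : ℂ} {a : Fin 3 → ℂ} {σ₁ σ₂ : ℂ → ℂ} {x : ℂ}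
    (h : PhiTildeRegular q A a σ₁ σ₂ x) :
    PhiRegular q (q / A) (fun i => q / a i) (fun y => σ₁ y⁻¹) (fun y => σ₂ y⁻¹) x⁻¹ := by
  simpa only [PhiTildeRegular, PhiRegular, NoPole, prodPsiTilde_eq, inv_inv] using h

theorem sigmaSet_inv_mem {q B : ℂ} {b : Fin 3 → ℂ} (hq0 : q ≠ 0) {σ : ℂ → ℂ}
    (hσ : σ ∈ sigmaSet B b) : (fun y => σ y⁻¹) ∈ tauSet q (q / B) fun i => q / b i := by
  have h : ∀ c : ℂ, q / (q / c) = c := fun c => div_div_cancel₀ hq0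
  have h' : (fun y : ℂ => q / (q / B * y)) = fun y => B * y⁻¹ := by
    ext y; rw [← div_div, h, div_eq_mul_inv]
  simp only [tauSet, h, h']
  rcases hσ with rfl | rfl | rfl | rfl <;> simp

/-- Inversion of `x` swaps the two shifts. The factors `B/A` and `A/B` are those which `x^λ`
acquires under `T_x` and its inverse. -/
theorem coeff_inv {q A B x : ℂ} {a b : Fin 3 → ℂ} (hq0 : q ≠ 0) (hA : A ≠ 0) (hB : B ≠ 0)
    (ha : ∀ i, a i ≠ 0) (hb : ∀ i, b i ≠ 0) (hAB : A * e3 a = q ^ 2 * B * e3 b) (hx : x ≠ 0) :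
    coeffPrev (q / A) (fun i => q / b i) x⁻¹ =
        -q / (B * e3 b * x ^ 3) * (coeffNext q A B a b x * (B / A)) ∧
      coeffId q (q / B) (q / A) (fun i => q / b i) (fun i => q / a i) x⁻¹ =
        -q / (B * e3 b * x ^ 3) * coeffId q A B a b x ∧
      coeffNext q (q / B) (q / A) (fun i => q / b i) (fun i => q / a i) x⁻¹ =
        -q / (B * e3 b * x ^ 3) * (coeffPrev B a x * (A / B)) := by
  have a0 := ha 0; have a1 := ha 1; have a2 := ha 2
  have b0 := hb 0; have b1 := hb 1; have b2 := hb 2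
  simp only [coeffPrev, coeffId, coeffNext, e1, e2, e3] at hAB ⊢
  obtain rfl : A = q ^ 2 * B * (b 0 * b 1 * b 2) / (a 0 * a 1 * a 2) := by
    rw [eq_div_iff (by simp [*]), hAB]
  refine ⟨?_, ?_, ?_⟩ <;> field_simp <;> ring

theorem coeff_phiTilde_eq_zero {q A B : ℂ} {a b : Fin 3 → ℂ} (hq0 : q ≠ 0) (hq : ‖q‖ < 1)
    (hA : A ≠ 0) (hB : B ≠ 0) (ha : ∀ i, a i ≠ 0) (hb : ∀ i, b i ≠ 0)
    (hBA : ∀ n : ℤ, B / A ≠ q ^ n)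
    (hAB : A * e3 a = q ^ 2 * B * e3 b) {x : ℂ} (hx : x ≠ 0) {σ₁ σ₂ : ℂ → ℂ}
    (hσ₁ : σ₁ ∈ sigmaSet B b) (hσ₂ : σ₂ ∈ sigmaSet B b)
    (h1 : PhiTildeRegular q A a σ₁ σ₂ (x / q)) (h2 : PhiTildeRegular q A a σ₁ σ₂ (q * x)) :
    coeffPrev B a x * (A / B) * phiTilde q A B a b σ₁ σ₂ (x / q)
      + coeffId q A B a b x * phiTilde q A B a b σ₁ σ₂ x
      + coeffNext q A B a b x * (B / A) * phiTilde q A B a b σ₁ σ₂ (q * x) = 0 := by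
  have i1 : (x / q)⁻¹ = q * x⁻¹ := by field_simp
  have i2 : (q * x)⁻¹ = x⁻¹ / q := by field_simp
  have a0 := ha 0; have a1 := ha 1; have a2 := ha 2
  have b0 := hb 0; have b1 := hb 1; have b2 := hb 2
  have r1 := h1.phiRegular
  have r2 := h2.phiRegular
  rw [i1] at r1
  rw [i2] at r2
  have hAB' : q / B * e3 (fun i => q / b i) = q ^ 2 * (q / A) * e3 fun i => q / a i := by
    simp only [e3] at hAB ⊢
    field_simp
    linear_combination hAB
  have hBA' : ∀ n : ℤ, q / A / (q / B) ≠ q ^ n := fun n => by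
    rw [show q / A / (q / B) = B / A by field_simp]; exact hBA n
  -- The regularity hypotheses enter in reverse order, since inversion exchanges `x/q` and `qx`.
  have key := coeff_phi_eq_zero hq0 hq (div_ne_zero hq0 hB) (div_ne_zero hq0 hA)
    (fun i => div_ne_zero hq0 (hb i)) hBA' hAB' (inv_ne_zero hx)
    (sigmaSet_inv_mem hq0 hσ₁) (sigmaSet_inv_mem hq0 hσ₂) r2 r1
  obtain ⟨c1, c2, c3⟩ := coeff_inv hq0 hA hB ha hb hAB hx
  rw [c1, c2, c3] at key
  simp only [phiTilde_eq, i1, i2]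
  have hr : -q / (B * e3 b * x ^ 3) ≠ 0 := by simp [e3, *]
  refine (mul_eq_zero_iff_left hr).1 ?_
  linear_combination key

/-! ### Powers of `q` and the change of parameters. -/

theorem qPow_add (l s t : ℂ) : qPow l (s + t) = qPow l s * qPow l t := by
  simp [qPow, add_mul, Complex.exp_add]

theorem qPow_ne_zero (l s : ℂ) : qPow l s ≠ 0 := Complex.exp_ne_zero _

theorem qPow_neg (l s : ℂ) : qPow l (-s) = (qPow l s)⁻¹ := by
  simp [qPow, Complex.exp_neg]

theorem qPow_sub (l s t : ℂ) : qPow l (s - t) = qPow l s / qPow l t := by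
  rw [sub_eq_add_neg, qPow_add, qPow_neg, div_eq_mul_inv]

theorem qPow_half_sq (l : ℂ) : qPow l (1 / 2) ^ 2 = Complex.exp l := by
  rw [pow_two, ← qPow_add, qPow]
  norm_num

theorem qPow_log_div {l : ℂ} (hl : l ≠ 0) {z : ℂ} (hz : z ≠ 0) : qPow l (Complex.log z / l) = z := by
  rw [qPow, div_mul_cancel₀ _ hl, Complex.exp_log hz]

/-- The square of `q ^ ν`, up to a shift which removes the half-integral powers of `q`. -/
theorem qPow_nu_sq (l : ℂ) (h k : Fin 3 → ℂ) :
    qPow l (nu h k) ^ 2 * ∏ i, qPow l (k i) = Complex.exp l * ∏ i, qPow l (h i) := by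
  rw [pow_two, ← qPow_add, Fin.prod_univ_three, Fin.prod_univ_three, ← qPow_add, ← qPow_add,
    ← qPow_add, ← qPow_add, ← qPow_add, show Complex.exp l = qPow l 1 by simp [qPow], ← qPow_add]
  simp only [nu, Fin.sum_univ_three]
  ring_nf

/-- The last two conditions of `ParamChange` without half-integral shifts. -/
theorem paramChange_iff {l A B : ℂ} {a b h k t : Fin 3 → ℂ} :
    ParamChange l A B a b h k t ↔ (qPow l (nu h k))⁻¹ = B / A ∧
      (∀ i, qPow l (k i) * t i = qPow l (1 / 2) * (b i / A)) ∧
      ∀ i, qPow l (1 / 2) * (qPow l (h i) * t i) = a i / B := by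
  have hr := qPow_ne_zero l (1 / 2)
  unfold ParamChange
  rw [qPow_neg]
  refine and_congr Iff.rfl (and_congr (forall_congr' fun i => ?_) (forall_congr' fun i => ?_))
  · rw [qPow_sub, div_mul_eq_mul_div, div_eq_iff hr, mul_comm (b i / A)]
  · rw [qPow_add, mul_comm (qPow l (h i)), mul_assoc]

/-- With `t = 1`, logarithms solve the conditions on `h` and `k`. The balancing condition then fixes
`q^ν` only up to sign, and the sign is repaired by another choice of logarithm. -/
theorem exists_paramChange {q l A B : ℂ} (hl0 : l ≠ 0) (hl : Complex.exp l = q)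
    {a b : Fin 3 → ℂ} (hA : A ≠ 0) (hB : B ≠ 0) (ha : ∀ i, a i ≠ 0) (hb : ∀ i, b i ≠ 0)
    (hAB : A * e3 a = q ^ 2 * B * e3 b) :
    ∃ h k t : Fin 3 → ℂ, (∀ i, t i ≠ 0) ∧ ParamChange l A B a b h k t := by
  have hq : q ≠ 0 := hl ▸ Complex.exp_ne_zero l
  set r := qPow l (1 / 2) with hrdef
  have hr : r ≠ 0 := qPow_ne_zero _ _
  have hr2 : r ^ 2 = q := by rw [hrdef, qPow_half_sq, hl]
  let h : Fin 3 → ℂ := fun i => Complex.log (a i / B / r) / l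
  let k : Fin 3 → ℂ := fun i => Complex.log (r * (b i / A)) / l
  have hh : ∀ i, qPow l (h i) = a i / B / r := fun i =>
    qPow_log_div hl0 (div_ne_zero (div_ne_zero (ha i) hB) hr)
  have hk : ∀ i, qPow l (k i) = r * (b i / A) := fun i =>
    qPow_log_div hl0 (mul_ne_zero hr (div_ne_zero (hb i) hA))
  have hsq : qPow l (nu h k) ^ 2 = (A / B) ^ 2 := by
    have := qPow_nu_sq l h k
    simp only [Fin.prod_univ_three, hh, hk, hl] at this
    have a0 := ha 0; have a1 := ha 1; have a2 := ha 2
    have b0 := hb 0; have b1 := hb 1; have b2 := hb 2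
    simp only [e3] at hAB
    have hr6 : r ^ 6 = q ^ 3 := by rw [← hr2]; ring
    field_simp at this ⊢
    rw [hr6] at this
    apply mul_right_cancel₀ (mul_ne_zero (mul_ne_zero (pow_ne_zero 2 hq) hB)
      (mul_ne_zero (mul_ne_zero b0 b1) b2))
    apply mul_left_cancel₀ hq
    linear_combination this + q * A ^ 2 * hAB
  rcases sq_eq_sq_iff_eq_or_eq_neg.1 hsq with hnu | hnu
  · refine ⟨h, k, fun _ => 1, fun _ => one_ne_zero, paramChange_iff.2 ⟨?_, fun i => ?_,
      fun i => ?_⟩⟩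
    · rw [hnu, inv_div]
    · rw [hk, mul_one]
    · rw [hh, ← hrdef]; field_simp
  -- Adding the period `2πi/l` to `h 0` preserves `q^(h 0)` but moves `ν` by `πi/l`, which flips the
  -- sign of `q^ν`.
  · have hper : qPow l (2 * Real.pi * Complex.I / l) = 1 := by
      rw [qPow, div_mul_cancel₀ _ hl0, Complex.exp_two_pi_mul_I]
    have hhalf : qPow l (Real.pi * Complex.I / l) = -1 := by
      rw [qPow, div_mul_cancel₀ _ hl0, Complex.exp_pi_mul_I]
    let h' : Fin 3 → ℂ := fun i => h i + if i = 0 then 2 * Real.pi * Complex.I / l else 0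
    have hh' : ∀ i, qPow l (h' i) = a i / B / r := fun i => by
      rw [qPow_add, hh]
      split_ifs
      · rw [hper, mul_one]
      · simp [qPow]
    have hnu' : nu h' k = nu h k + Real.pi * Complex.I / l := by
      simp [nu, h', Finset.sum_add_distrib]; ring
    refine ⟨h', k, fun _ => 1, fun _ => one_ne_zero, paramChange_iff.2 ⟨?_, fun i => ?_,
      fun i => ?_⟩⟩
    · rw [hnu', qPow_add, hnu, hhalf, neg_mul_neg, mul_one, inv_div]
    · rw [hk, mul_one]
    · rw [hh', ← hrdef]; field_simp

theorem exists_paramChange_symm {q l : ℂ} (hl : Complex.exp l = q) (h k : Fin 3 → ℂ)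
    {t : Fin 3 → ℂ} (ht : ∀ i, t i ≠ 0) :
    ∃ (A B : ℂ) (a b : Fin 3 → ℂ), A ≠ 0 ∧ B ≠ 0 ∧ (∀ i, a i ≠ 0) ∧ (∀ i, b i ≠ 0) ∧
      A * e3 a = q ^ 2 * B * e3 b ∧ ParamChange l A B a b h k t := by
  set r := qPow l (1 / 2) with hrdef
  have hr : r ≠ 0 := qPow_ne_zero _ _
  have hr2 : r ^ 2 = q := by rw [hrdef, qPow_half_sq, hl]
  have hn := qPow_ne_zero l (nu h k)
  -- After the normalisation `A = 1`, the remaining parameters are forced.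
  refine ⟨1, (qPow l (nu h k))⁻¹, fun i => r * (qPow l (h i) * t i) * (qPow l (nu h k))⁻¹,
    fun i => qPow l (k i) * t i / r, one_ne_zero, inv_ne_zero hn, fun i => ?_, fun i => ?_, ?_,
    paramChange_iff.2 ⟨by simp, fun i => ?_, fun i => ?_⟩⟩
  · simp [hr, qPow_ne_zero, ht]
  · simp [hr, qPow_ne_zero, ht]
  · have := qPow_nu_sq l h k
    rw [hl, Fin.prod_univ_three, Fin.prod_univ_three] at this
    simp only [e3]
    field_simp
    rw [show r ^ 6 = q ^ 3 by rw [← hr2]; ring]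
    linear_combination (-q ^ 2 * t 0 * t 1 * t 2) * this
  · rw [← hrdef]; field_simp
  · rw [← hrdef]; field_simp

/-! ### Comparison of the coefficients of the two operators. -/

theorem opH3_apply (q l α : ℂ) (h k t : Fin 3 → ℂ) (f : ℂ → ℂ) (u : ℂ) :
    opH3 q l α h k t f u =
      (∏ i, (Complex.exp u - qPow l (h i + 1 / 2) * t i)) * f (u - l)
      + qPow l (2 * α + 1) * (∏ i, (Complex.exp u - qPow l (k i - 1 / 2) * t i)) * f (u + l)
      + qPow l α * (-(q + 1) * Complex.exp u ^ 3
        + (qPow l (1 / 2) * ∑ i, (qPow l (h i) + qPow l (k i)) * t i) * Complex.exp u ^ 2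
        - (qPow l ((∑ i, h i + ∑ i, k i + 1) / 2) * (∏ i, t i)
            * ∑ i, (qPow l (-h i) + qPow l (-k i)) / t i) * Complex.exp u
        + qPow l ((∑ i, h i + ∑ i, k i) / 2) * (q + 1) * ∏ i, t i) * f u := by
  simp only [opH3, opX, opMul, opT, opTinv, Module.End.mul_apply,
    LinearMap.sub_apply, LinearMap.add_apply, LinearMap.smul_apply, Module.End.one_apply,
    LinearMap.funLeft_apply, LinearMap.mulLeft_apply, Pi.sub_apply, Pi.add_apply, Pi.smul_apply,
    Pi.mul_apply, smul_eq_mul, pow_succ, pow_zero, one_mul, neg_smul, Pi.neg_apply]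
  ring

theorem coeffPrev_eq {B : ℂ} (hB : B ≠ 0) (a : Fin 3 → ℂ) (x : ℂ) :
    ∏ i, (x - a i / B) = coeffPrev B a x / B ^ 2 := by
  simp only [coeffPrev, e1, e2, e3, Fin.prod_univ_three]
  field_simp
  ring

theorem coeffNext_eq {q A B : ℂ} {a b : Fin 3 → ℂ} (hq : q ≠ 0) (hA : A ≠ 0) (hB : B ≠ 0)
    (hAB : A * e3 a = q ^ 2 * B * e3 b) (x : ℂ) :
    ∏ i, (x - b i / A) = coeffNext q A B a b x / (q * A ^ 2) := by
  have h : e3 a * B⁻¹ * q⁻¹ = q * e3 b / A := by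
    field_simp; linear_combination hAB
  rw [coeffNext, h]
  simp only [e1, e2, e3, Fin.prod_univ_three]
  field_simp
  ring

theorem coeffId_eq {q l A B : ℂ} (hl : Complex.exp l = q) {a b h k t : Fin 3 → ℂ}
    (hA : A ≠ 0) (hB : B ≠ 0) (ha : ∀ i, a i ≠ 0) (hb : ∀ i, b i ≠ 0)
    (hAB : A * e3 a = q ^ 2 * B * e3 b) (hP : ParamChange l A B a b h k t) (x : ℂ) :
    -(q + 1) * x ^ 3
        + (qPow l (1 / 2) * ∑ i, (qPow l (h i) + qPow l (k i)) * t i) * x ^ 2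
        - (qPow l ((∑ i, h i + ∑ i, k i + 1) / 2) * (∏ i, t i)
            * ∑ i, (qPow l (-h i) + qPow l (-k i)) / t i) * x
        + qPow l ((∑ i, h i + ∑ i, k i) / 2) * (q + 1) * ∏ i, t i
      = coeffId q A B a b x / (A * B) := by
  obtain ⟨hn, hk, hh⟩ := paramChange_iff.1 hP
  have ht : ∀ i, t i ≠ 0 := fun i h0 => div_ne_zero (ha i) hB (by rw [← hh, h0]; ring)
  have hr := qPow_ne_zero l (1 / 2)
  have hr2 : q = qPow l (1 / 2) ^ 2 := by rw [qPow_half_sq, hl]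
  have hn' : qPow l (nu h k) = A / B := by rw [← inv_div, ← hn, inv_inv]
  -- The exponent equals `ν + ∑ k`. Thus the half-sums involve no new square root: all becomes
  -- rational in `q^(1/2)`.
  have s1 : qPow l ((∑ i, h i + ∑ i, k i + 1) / 2) = A / B * ∏ i, qPow l (k i) := by
    rw [← hn', Fin.prod_univ_three, ← qPow_add, ← qPow_add, ← qPow_add]
    simp only [nu, Fin.sum_univ_three]
    ring_nf
  have s2 : qPow l ((∑ i, h i + ∑ i, k i) / 2)
      = A / B * (∏ i, qPow l (k i)) / qPow l (1 / 2) := by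
    rw [← s1, ← qPow_sub]
    ring_nf
  have hk' : ∀ i, qPow l (k i) = qPow l (1 / 2) * (b i / A) / t i := fun i => by
    rw [eq_div_iff (ht i), hk]
  have hh' : ∀ i, qPow l (h i) = a i / B / t i / qPow l (1 / 2) := fun i => by
    rw [eq_div_iff hr, eq_div_iff (ht i), ← hh]; ring
  rw [s1, s2]
  simp only [qPow_neg, hk', hh', Fin.prod_univ_three, Fin.sum_univ_three]
  generalize qPow l (1 / 2) = r at hr hr2
  subst hr2
  have a0 := ha 0; have a1 := ha 1; have a2 := ha 2
  have b0 := hb 0; have b1 := hb 1; have b2 := hb 2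
  have t0 := ht 0; have t1 := ht 1; have t2 := ht 2
  simp only [coeffId, e1, e2, e3] at hAB ⊢
  obtain rfl : A = (r ^ 2) ^ 2 * B * (b 0 * b 1 * b 2) / (a 0 * a 1 * a 2) := by
    rw [eq_div_iff (by simp [*]), hAB]
  field_simp
  ring

/-- Moving `x^(ν-α)` past `T_x⁻¹` and `T_x` yields `q^α B/A` and `q^(-α) A/B`. These turn the
normalisations `1/B²` and `q^(2α+1)/(q A²)` of the outer coefficients into the common `q^α/(AB)`. -/
theorem opH3_xPow_apply {q l A B : ℂ} (hl : Complex.exp l = q) {a b h k t : Fin 3 → ℂ}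
    (hA : A ≠ 0) (hB : B ≠ 0) (ha : ∀ i, a i ≠ 0) (hb : ∀ i, b i ≠ 0)
    (hAB : A * e3 a = q ^ 2 * B * e3 b) (hP : ParamChange l A B a b h k t) (α : ℂ)
    (f : ℂ → ℂ) (u : ℂ) :
    opH3 q l α h k t (fun v => xPow (nu h k - α) v * f v) u =
      qPow l α / (A * B) * (xPow (nu h k - α) u * opE3 q l A B a b f u) := by
  have hq : q ≠ 0 := hl ▸ Complex.exp_ne_zero l
  rw [opH3_apply, coeffId_eq hl hA hB ha hb hAB hP, opE3_apply]
  obtain ⟨hn, hk, hh⟩ := hP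
  have hn' : qPow l (nu h k) = A / B := by rw [← inv_div, ← hn, qPow_neg, inv_inv]
  have p := qPow_ne_zero l α
  have x1 : xPow (nu h k - α) (u - l) = xPow (nu h k - α) u * (qPow l α * (B / A)) := by
    have : qPow l α * (B / A) = qPow l (-(nu h k - α)) := by
      rw [qPow_neg, qPow_sub, hn', inv_div, div_div_eq_mul_div, mul_div_assoc]
    rw [this, xPow, xPow, qPow, ← Complex.exp_add]
    ring_nf
  have x2 : xPow (nu h k - α) (u + l) = xPow (nu h k - α) u * (A / B / qPow l α) := by
    rw [← hn', ← qPow_sub, xPow, xPow, qPow, ← Complex.exp_add]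
    ring_nf
  have x3 : qPow l (2 * α + 1) = qPow l α ^ 2 * q := by
    rw [pow_two, ← qPow_add, ← hl, show Complex.exp l = qPow l 1 by simp [qPow], ← qPow_add]
    ring_nf
  simp only [hk, hh, x1, x2, x3, coeffPrev_eq hB, coeffNext_eq hq hA hB hAB]
  field_simp
  ring

/-! ### The integral solutions in the logarithmic variable. -/

theorem opE3_phi {q l A B : ℂ} (hq : ‖q‖ < 1) (hl : Complex.exp l = q) {a b : Fin 3 → ℂ}
    (hA : A ≠ 0) (hB : B ≠ 0) (ha : ∀ i, a i ≠ 0) (hBA : ∀ n : ℤ, B / A ≠ q ^ n)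
    (hAB : A * e3 a = q ^ 2 * B * e3 b) {τ₁ τ₂ : ℂ → ℂ}
    (hτ₁ : τ₁ ∈ tauSet q A a) (hτ₂ : τ₂ ∈ tauSet q A a) {u : ℂ}
    (h1 : PhiRegular q B b τ₁ τ₂ (Complex.exp (u - l)))
    (h2 : PhiRegular q B b τ₁ τ₂ (Complex.exp (u + l))) :
    opE3 q l A B a b (fun v => phi q A B a b τ₁ τ₂ (Complex.exp v)) u = 0 := by
  have m1 : Complex.exp (u - l) = Complex.exp u / q := by rw [Complex.exp_sub, hl]
  have m2 : Complex.exp (u + l) = q * Complex.exp u := by rw [Complex.exp_add, hl, mul_comm]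
  rw [m1] at h1
  rw [m2] at h2
  rw [opE3_apply, m1, m2]
  exact coeff_phi_eq_zero (hl ▸ Complex.exp_ne_zero l) hq hA hB ha hBA hAB
    (Complex.exp_ne_zero u) hτ₁ hτ₂ h1 h2

theorem opE3_phiTilde {q l A B lam : ℂ} (hq : ‖q‖ < 1) (hl : Complex.exp l = q) {a b : Fin 3 → ℂ}
    (hA : A ≠ 0) (hB : B ≠ 0) (ha : ∀ i, a i ≠ 0) (hb : ∀ i, b i ≠ 0)
    (hlam : qPow l lam = B / A) (hBA : ∀ n : ℤ, B / A ≠ q ^ n)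
    (hAB : A * e3 a = q ^ 2 * B * e3 b) {σ₁ σ₂ : ℂ → ℂ}
    (hσ₁ : σ₁ ∈ sigmaSet B b) (hσ₂ : σ₂ ∈ sigmaSet B b) {u : ℂ}
    (h1 : PhiTildeRegular q A a σ₁ σ₂ (Complex.exp (u - l)))
    (h2 : PhiTildeRegular q A a σ₁ σ₂ (Complex.exp (u + l))) :
    opE3 q l A B a b (fun v => xPow lam v * phiTilde q A B a b σ₁ σ₂ (Complex.exp v)) u = 0 := by
  have m1 : Complex.exp (u - l) = Complex.exp u / q := by rw [Complex.exp_sub, hl]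
  have m2 : Complex.exp (u + l) = q * Complex.exp u := by rw [Complex.exp_add, hl, mul_comm]
  have x1 : xPow lam (u - l) = xPow lam u * (A / B) := by
    rw [← inv_div, ← hlam, xPow, xPow, qPow, mul_sub, Complex.exp_sub, div_eq_mul_inv]
  have x2 : xPow lam (u + l) = xPow lam u * (B / A) := by
    rw [← hlam, xPow, xPow, qPow, mul_add, Complex.exp_add]
  rw [m1] at h1
  rw [m2] at h2
  rw [opE3_apply, m1, m2, x1, x2]
  linear_combination xPow lam u * coeff_phiTilde_eq_zero (hl ▸ Complex.exp_ne_zero l) hq hA hB ha hb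
    hBA hAB (Complex.exp_ne_zero u) hσ₁ hσ₂ h1 h2

end VariantQHyp

end

theorem mainTheorem1 (q l : ℂ) (hq0 : 0 < ‖q‖) (hq1 : ‖q‖ < 1) (hl : Complex.exp l = q) :
    -- the two families of Jackson integrals solve the equation
    (∀ (A B lam : ℂ) (a b : Fin 3 → ℂ), A ≠ 0 → B ≠ 0 → (∀ i, a i ≠ 0) → (∀ i, b i ≠ 0) →
      qPow l lam = B / A → (∀ n : ℤ, B / A ≠ q ^ n) →
      A * e3 a = q ^ 2 * B * e3 b →
      (∀ τ₁ ∈ tauSet q A a, ∀ τ₂ ∈ tauSet q A a,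
        (∀ x : ℂ, x ≠ 0 → PhiRegular q B b τ₁ τ₂ x →
          Summable (jacksonTerm q (psi q A B a b x) (τ₁ x)) ∧
          Summable (jacksonTerm q (psi q A B a b x) (τ₂ x))) ∧
        ∀ u : ℂ,
          PhiRegular q B b τ₁ τ₂ (Complex.exp (u - l)) →
          PhiRegular q B b τ₁ τ₂ (Complex.exp u) →
          PhiRegular q B b τ₁ τ₂ (Complex.exp (u + l)) →
          opE3 q l A B a b (fun v => phi q A B a b τ₁ τ₂ (Complex.exp v)) u = 0) ∧
      (∀ σ₁ ∈ sigmaSet B b, ∀ σ₂ ∈ sigmaSet B b,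
        (∀ x : ℂ, x ≠ 0 → PhiTildeRegular q A a σ₁ σ₂ x →
          Summable (jacksonTerm q (psiTilde q A B a b x) (σ₁ x)) ∧
          Summable (jacksonTerm q (psiTilde q A B a b x) (σ₂ x))) ∧
        ∀ u : ℂ,
          PhiTildeRegular q A a σ₁ σ₂ (Complex.exp (u - l)) →
          PhiTildeRegular q A a σ₁ σ₂ (Complex.exp u) →
          PhiTildeRegular q A a σ₁ σ₂ (Complex.exp (u + l)) →
          opE3 q l A B a b
            (fun v => xPow lam v * phiTilde q A B a b σ₁ σ₂ (Complex.exp v)) u = 0)) ∧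
    -- every `𝓔₃` has corresponding parameters of some `𝓗₃`
    (∀ (A B : ℂ) (a b : Fin 3 → ℂ), A ≠ 0 → B ≠ 0 → (∀ i, a i ≠ 0) → (∀ i, b i ≠ 0) →
      A * e3 a = q ^ 2 * B * e3 b →
      ∃ h k t : Fin 3 → ℂ, (∀ i, t i ≠ 0) ∧ ParamChange l A B a b h k t) ∧
    -- every `𝓗₃` has corresponding parameters of some `𝓔₃`
    (∀ h k t : Fin 3 → ℂ, (∀ i, t i ≠ 0) →
      ∃ (A B : ℂ) (a b : Fin 3 → ℂ), A ≠ 0 ∧ B ≠ 0 ∧ (∀ i, a i ≠ 0) ∧ (∀ i, b i ≠ 0) ∧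
        A * e3 a = q ^ 2 * B * e3 b ∧ ParamChange l A B a b h k t) ∧
    -- for corresponding parameters, `g(x) = x ^ (ν - α) f(x)` carries one equation to the other
    (∀ (A B α : ℂ) (a b h k t : Fin 3 → ℂ), A ≠ 0 → B ≠ 0 → (∀ i, a i ≠ 0) → (∀ i, b i ≠ 0) →
      A * e3 a = q ^ 2 * B * e3 b → ParamChange l A B a b h k t →
      (∃ c : ℂ, c ≠ 0 ∧
        opH3 q l α h k t * opMul (xPow (nu h k - α)) =
          c • (opMul (xPow (nu h k - α)) * opE3 q l A B a b)) ∧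
      ∀ (f : ℂ → ℂ) (u : ℂ),
        opE3 q l A B a b f u = 0 ↔
          opH3 q l α h k t (fun v => xPow (nu h k - α) v * f v) u = 0) := by
  have hq : q ≠ 0 := norm_pos_iff.1 hq0
  have hl0 : l ≠ 0 := by
    rintro rfl
    rw [Complex.exp_zero] at hl
    simp [← hl] at hq1
  refine ⟨fun A B lam a b hA hB ha hb hlam hBA hAB => ⟨fun τ₁ hτ₁ τ₂ hτ₂ => ⟨fun x _ _ =>
      ⟨summable_jacksonTerm_psi hq1 .., summable_jacksonTerm_psi hq1 ..⟩,
      fun u h1 _ h2 => opE3_phi hq1 hl hA hB ha hBA hAB hτ₁ hτ₂ h1 h2⟩,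
    fun σ₁ hσ₁ σ₂ hσ₂ => ⟨fun x _ _ => ?_,
      fun u h1 _ h2 => opE3_phiTilde hq1 hl hA hB ha hb hlam hBA hAB hσ₁ hσ₂ h1 h2⟩⟩,
    fun A B a b hA hB ha hb hAB => exists_paramChange hl0 hl hA hB ha hb hAB,
    fun h k t ht => exists_paramChange_symm hl h k ht,
    fun A B α a b h k t hA hB ha hb hAB hP => ?_⟩
  · rw [psiTilde_eq]
    exact ⟨summable_jacksonTerm_psi hq1 .., summable_jacksonTerm_psi hq1 ..⟩
  · have hc : qPow l α / (A * B) ≠ 0 := div_ne_zero (qPow_ne_zero _ _) (mul_ne_zero hA hB)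
    have key := opH3_xPow_apply hl hA hB ha hb hAB hP α
    refine ⟨⟨_, hc, LinearMap.ext fun f => funext fun u => key f u⟩, fun f u => ?_⟩
    rw [key, mul_eq_zero_iff_left hc, xPow, mul_eq_zero_iff_left (Complex.exp_ne_zero _)]
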